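/- All groups are finite. A subgroup $H$ of a group $G$ is a T.I. subgroup if for every $x\in G$ the intersection $H\cap H^x$ is either $H$ or trivial, and a Hall subgroup of $K\ge H$ if $|H|$ is coprime to $|K:H|$. For a set $\pi$ of primes, $G$ is $\pi$-separable if it has a normal series each of whose factors is a $\pi$-group or a $\pi'$-group, and $O_{\pi'}(G)$ denotes the largest normal $\pi'$-subgroup of $G$. A group $NK$ is a Frobenius group with kernel $N$ and complement $K$ if $N$ and $K$ are nontrivial, $NK=N\rtimes K$, and every nonidentity element of $K$ acts fixed point freely on $N$ by conjugation. A group $L$ is a double Frobenius group with factors $A,B,C$ if $L=(A\rtimes B)\rtimes C$, where $AB$ is a Frobenius group with kernel $A$ and complement $B$, and $BC$ is a Frobenius group with kernel $B$ and complement $C$. **Theorem.** Let $G$ be a finite group, let $H$ be a nonnormal T.I. subgroup of $G$, and let $\pi$ be the set of primes dividing $|H|$. Assume that $G$ is $\pi$-separable and that $H$ is a Hall subgroup of $N_G(H)$. Let $Q$ be any complement of $H$ in $N_G(H)$ (that is, $N_G(H)=HQ$ and $H\cap Q=1$), and put $O=O_{\pi'}(G)$ and $O'=[O,O]$. Assume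 further that $|H|$ is odd, $[O,H]=O$, $O$ is solvable, and $Q\not\le O'$. Let $\overline{G}=G/O'$, and write $\overline{X}$ for the image of a subgroup $X$ of $G$ in $\overline{G}$. Then: (a) $\overline{G}=(\overline{O}\rtimes\overline{H})\rtimes\overline{Q}$; (b) $\overline{Q}$ is abelian, normalizes $\overline{H}$, and acts faithfully on $\overline{H}$ by conjugation; (c) for every $\beta\in\overline{Q}$ of prime order, $\overline{O}\,[\overline{H},\beta]\,\langle\beta\rangle$ is a double Frobenius group with factors $\overline{O}$, $[\overline{H},\beta]$ and $\langle\beta\rangle$. -/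

import Mathlib

open scoped Pointwise

/-- `n` is a `π`-number: every prime divisor of `n` lies in `π`. -/
def IsPiNumber (π : Set ℕ) (n : ℕ) : Prop :=
  ∀ p : ℕ, p.Prime → p ∣ n → p ∈ π

/-- The set of primes dividing the order of the subgroup `H`. -/
def Subgroup.primeDivisors {G : Type*} [Group G] (H : Subgroup G) : Set ℕ :=
  {p : ℕ | p.Prime ∧ p ∣ Nat.card H}

/-- A finite group `G` is `π`-separable: it has a normal series
`1 = N 0 ≤ N 1 ≤ ⋯ ≤ N n = G` each of whose factors is a `π`-group or a `π'`-group. -/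
def IsPiSeparable (π : Set ℕ) (G : Type*) [Group G] : Prop :=
  ∃ (n : ℕ) (N : ℕ → Subgroup G),
    N 0 = ⊥ ∧ N n = ⊤ ∧ (∀ i, i ≤ n → (N i).Normal) ∧
    ∀ i, i < n → N i ≤ N (i + 1) ∧
      (IsPiNumber π ((N i).relIndex (N (i + 1))) ∨
        IsPiNumber πᶜ ((N i).relIndex (N (i + 1))))

/-- `O_π(G)`: the subgroup generated by all normal `π`-subgroups of `G`; in a finite group it is
the largest normal `π`-subgroup. -/
def piCore (π : Set ℕ) (G : Type*) [Group G] : Subgroup G :=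
  sSup {N : Subgroup G | N.Normal ∧ IsPiNumber π (Nat.card N)}

instance piCore_normal (π : Set ℕ) (G : Type*) [Group G] : (piCore π G).Normal := by
  refine Subgroup.normalizer_eq_top_iff.mp (top_unique fun g _ => ?_)
  have key : ∀ g : G, (piCore π G).map (MulAut.conj g).toMonoidHom ≤ piCore π G := by
    intro g
    rw [Subgroup.map_le_iff_le_comap]
    refine sSup_le fun N hN => ?_
    intro x hx
    exact (le_sSup hN : N ≤ piCore π G) (hN.1.conj_mem x hx g)
  rw [Subgroup.mem_normalizer_iff]
  intro x
  refine ⟨fun hx => key g ⟨x, hx, rfl⟩, fun hx => ?_⟩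
  have h := key g⁻¹ ⟨_, hx, rfl⟩
  simpa [mul_assoc] using h

/-- `O_{π'}(G)`, where `π` is the set of primes dividing the order of the subgroup `H` of `G`. -/
abbrev Subgroup.piPrimeCore {G : Type*} [Group G] (H : Subgroup G) : Subgroup G :=
  piCore (H.primeDivisors)ᶜ G

namespace Subgroup

variable {G : Type*} [Group G]

/-- `H` is a T.I. subgroup: each conjugate `x H x⁻¹` meets `H` in `H` or in the trivial group. -/
def IsTI (H : Subgroup G) : Prop :=
  ∀ x : G, H ⊓ MulAut.conj x • H = H ∨ H ⊓ MulAut.conj x • H = ⊥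

/-- `H` is a Hall subgroup of the subgroup `K`: `H ≤ K` and `|H|` is coprime to `|K : H|`. -/
def IsHallIn (H K : Subgroup G) : Prop :=
  H ≤ K ∧ (Nat.card H).Coprime (H.relIndex K)

/-- `Q` is a complement of `H` in the subgroup `K`: `H` and `Q` are subgroups of `K` with
`H ∩ Q = 1` and `K = HQ`. -/
def IsComplementIn (Q H K : Subgroup G) : Prop :=
  H ≤ K ∧ Q ≤ K ∧ H ⊓ Q = ⊥ ∧ (H : Set G) * (Q : Set G) = (K : Set G)

/-- `L = N ⋊ K` as an internal semidirect product of subgroups: `N` and `K` are subgroups of `L`,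
`N` is normal in `L`, `N ∩ K = 1` and `L = NK`. -/
def IsInternalSemidirect (L N K : Subgroup G) : Prop :=
  IsComplementIn K N L ∧ ∀ x ∈ L, ∀ n ∈ N, x * n * x⁻¹ ∈ N

/-- `Q` acts on `H` by conjugation (that is, it normalizes `H`) and this action is faithful. -/
def ActsFaithfullyOn (Q H : Subgroup G) : Prop :=
  (∀ q ∈ Q, ∀ h ∈ H, q * h * q⁻¹ ∈ H) ∧
    ∀ q ∈ Q, (∀ h ∈ H, q * h * q⁻¹ = h) → q = 1

/-- `L` is a Frobenius group with kernel `N` and complement `K`: `N` and `K` are nontrivial,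
`L = N ⋊ K`, and every nonidentity element of `K` acts fixed point freely on `N`. -/
def IsFrobeniusGroup (L N K : Subgroup G) : Prop :=
  N ≠ ⊥ ∧ K ≠ ⊥ ∧ IsInternalSemidirect L N K ∧
    ∀ k ∈ K, k ≠ 1 → ∀ n ∈ N, k * n * k⁻¹ = n → n = 1

/-- `L` is a double Frobenius group with factors `A`, `B`, `C`: `L = (A ⋊ B) ⋊ C`, where `AB` is a
Frobenius group with kernel `A` and complement `B`, and `BC` is a Frobenius group with kernel `B`
and complement `C`. -/
def IsDoubleFrobeniusGroup (L A B C : Subgroup G) : Prop :=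
  IsInternalSemidirect L (A ⊔ B) C ∧
    IsFrobeniusGroup (A ⊔ B) A B ∧ IsFrobeniusGroup (B ⊔ C) B C

end Subgroup

/-! By T.I. the normalizer of a nontrivial subgroup of $H$ lies in $N_G(H)$, so Sylow subgroups of
$H$ are Sylow in $G$ and $H$ is a Hall subgroup of $G$. A Frattini argument with $\pi$-separability
then gives $G = N_G(H)O$ (`IsTI.normalizer_sup_piPrimeCore`). Modulo $O'$ the group $\overline O$ is
abelian, and $[\overline O,\overline H]=\overline O$ with coprime orders forces $C_{\overline
O}(\overline H)=1$. A fixed point in $\overline O$ of an element $h^k$ of prime order lifts to an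
element of $O$ commuting with $h^k$; by T.I. the lift normalizes $H$, hence centralizes it, so the
fixed point is trivial. Thus $\overline H$ acts fixed point freely. The subgroup $C_{\overline
Q}(\overline H)\overline O$ is normal with $\pi'$-preimage in $G$, hence lies in $\overline O$, and
$\overline Q$ is faithful on $\overline H$. Since $|\overline H|$ is odd, its Sylow subgroups are
cyclic, so it has a cyclic self-centralizing subgroup $F$ invariant under $\overline Q$
(`exists_isCyclic_self_centralizing`). As $\mathrm{Aut}(F)$ is abelian, $[\overline H,\overline
Q]\le F$; coprimality gives $\overline H = F\,C_{\overline H}(\beta)$, so $\overline Q$ embeds in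
$\mathrm{Aut}(F)$ and is abelian, while $[\overline H,\beta]=[F,\beta]$ contains no nontrivial fixed
point of $\beta$. -/

/-! ### Cyclicity of $p$-groups of odd order -/

/-- If commutators of `x` and `y` are central, then `(x * y) ^ n` is given by the class two
collection formula. -/
theorem mul_pow_of_commutator_mem_center {P : Type*} [Group P] {x y c : P}
    (hc : ∀ z, c * z = z * c) (hyx : y * x = x * y * c) (n : ℕ) :
    (x * y) ^ n = x ^ n * y ^ n * c ^ n.choose 2 := by
  have hcp : ∀ k z, c ^ k * z = z * c ^ k := fun k z =>
    ((show Commute c z from hc z).pow_left k).eq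
  have hyn : ∀ n : ℕ, y ^ n * x = x * y ^ n * c ^ n := by
    intro n
    induction n with
    | zero => simp
    | succ n ih =>
      calc y ^ (n + 1) * x = y ^ n * (y * x) := by rw [pow_succ]; group
        _ = (y ^ n * x) * y * c := by rw [hyx]; group
        _ = x * y ^ n * (c ^ n * y) * c := by rw [ih]; group
        _ = x * y ^ (n + 1) * c ^ (n + 1) := by rw [hcp]; simp only [pow_succ, mul_assoc]
  induction n with
  | zero => simp
  | succ n ih =>
    calc (x * y) ^ (n + 1) = x ^ n * y ^ n * (c ^ n.choose 2 * (x * y)) := by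
          rw [pow_succ, ih]; group
      _ = x ^ n * (y ^ n * x) * y * c ^ n.choose 2 := by rw [hcp]; group
      _ = x ^ (n + 1) * y ^ n * (c ^ n * y) * c ^ n.choose 2 := by
          rw [hyn]; simp only [pow_succ, mul_assoc]
      _ = x ^ (n + 1) * y ^ (n + 1) * (c ^ n * c ^ n.choose 2) := by
          rw [hcp]; simp only [pow_succ, mul_assoc]
      _ = _ := by
          rw [← pow_add, Nat.choose_succ_succ' n 1, Nat.choose_one_right]

/-- The quotient by a normal subgroup of prime index is commutative and has prime exponent. -/
theorem Subgroup.pow_mem_and_commutator_mem_of_index_eq_prime {P : Type*} [Group P] {p : ℕ}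
    [hp : Fact p.Prime] (M : Subgroup P) [M.Normal] (hM : M.index = p) :
    (∀ x, x ^ p ∈ M) ∧ ∀ x y, (x * y)⁻¹ * (y * x) ∈ M := by
  refine ⟨fun x => hM ▸ M.pow_index_mem x, fun x y => ?_⟩
  have : IsCyclic (P ⧸ M) := isCyclic_of_prime_card (p := p) (by rw [← hM, M.index_eq_card])
  rw [← QuotientGroup.eq]
  exact (IsCyclic.commGroup (α := P ⧸ M)).mul_comm (x : P ⧸ M) y

/-- A finite `p`-group, `p` odd, without elementary abelian subgroups of rank two is cyclic. -/
theorem isCyclic_of_card_eq_odd_prime_pow {p : ℕ} [hp : Fact p.Prime] (hodd : Odd p) (n : ℕ) :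
    ∀ (P : Type*) [Group P] [Finite P], Nat.card P = p ^ n →
      (∀ x y : P, x * y = y * x → x ^ p = 1 → y ^ p = 1 → y ≠ 1 → x ∈ Subgroup.zpowers y) →
      IsCyclic P := by
  induction n with
  | zero =>
    intro P _ _ hcard _
    have : Subsingleton P := (Nat.card_eq_one_iff_unique.mp (by simpa using hcard)).1
    infer_instance
  | succ n ih =>
    intro P _ _ hcard huniq
    by_contra hcyc
    have hpg : IsPGroup p P := IsPGroup.of_card hcard
    have hpos : 0 < p ^ n := pow_pos hp.out.pos n
    have hindex : ∀ M : Subgroup P, Nat.card M = p ^ n → M.index = p := by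
      intro M hM
      have := M.card_mul_index
      rw [hM, hcard, pow_succ] at this
      exact Nat.eq_of_mul_eq_mul_left hpos this
    have hnormal : ∀ M : Subgroup P, Nat.card M = p ^ n → M.Normal := by
      intro M hM
      refine Subgroup.normal_of_index_eq_minFac_card ?_
      rw [hindex M hM, hcard, hp.out.pow_minFac n.succ_ne_zero]
    have hcyclic : ∀ M : Subgroup P, Nat.card M = p ^ n → IsCyclic M := by
      intro M hM
      refine ih M hM fun x y hxy hx hy hy1 => ?_
      have := huniq x y (by exact_mod_cast congrArg Subtype.val hxy)
        (by exact_mod_cast congrArg Subtype.val hx) (by exact_mod_cast congrArg Subtype.val hy)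
        (by simpa using hy1)
      obtain ⟨k, hk⟩ := Subgroup.mem_zpowers_iff.mp this
      exact Subgroup.mem_zpowers_iff.mpr ⟨k, Subtype.ext (by simpa using hk)⟩
    obtain ⟨M₁, h₁⟩ := Sylow.exists_subgroup_card_pow_prime (G := P) p (n := n)
      (hcard ▸ pow_dvd_pow p n.le_succ)
    -- As $P$ is not cyclic, $\langle g\rangle$ is proper and lies in a second maximal subgroup
    -- $M_2\ne M_1$. Both are cyclic by induction and generate $P$, so $M_1\cap M_2$ is central.
    obtain ⟨g, hg⟩ : ∃ g, g ∉ M₁ := by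
      by_contra! h
      have := hindex M₁ h₁
      rw [(Subgroup.eq_top_iff' M₁).mpr h, Subgroup.index_top] at this
      exact hp.out.one_lt.ne this
    obtain ⟨k, hk⟩ := IsPGroup.iff_card.mp (hpg.to_subgroup (Subgroup.zpowers g))
    have hkn : k ≤ n := by
      have hle : k ≤ n + 1 := by
        have := (Subgroup.zpowers g).card_subgroup_dvd_card
        rw [hk, hcard] at this
        exact (Nat.pow_dvd_pow_iff_le_right hp.out.one_lt).mp this
      rcases hle.lt_or_eq with h | h
      · exact Nat.lt_succ_iff.mp h
      · exfalso
        apply hcyc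
        refine isCyclic_iff_exists_zpowers_eq_top.mpr ⟨g, Subgroup.eq_top_of_card_eq _ ?_⟩
        rw [hk, hcard, h]
    obtain ⟨M₂, h₂, hgM⟩ := Sylow.exists_subgroup_card_pow_prime_le (G := P) p (m := n)
      (hcard ▸ pow_dvd_pow p n.le_succ) (Subgroup.zpowers g) hk hkn
    have hne : M₁ ≠ M₂ := fun h => hg (h ▸ hgM (Subgroup.mem_zpowers g))
    have := hnormal M₁ h₁
    have := hnormal M₂ h₂
    have := hcyclic M₁ h₁
    have := hcyclic M₂ h₂
    have hsup : M₁ ⊔ M₂ = ⊤ := by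
      have h := Subgroup.relIndex_mul_index (le_sup_left : M₁ ≤ M₁ ⊔ M₂)
      rw [hindex M₁ h₁] at h
      rcases (Nat.dvd_prime hp.out).mp (Dvd.intro_left _ h) with h' | h'
      · exact Subgroup.index_eq_one.mp h'
      · exfalso
        rw [h'] at h
        have h1 : M₁.relIndex (M₁ ⊔ M₂) = 1 :=
          Nat.eq_of_mul_eq_mul_right hp.out.pos (by rw [h, one_mul])
        have hle : M₂ ≤ M₁ := le_sup_right.trans (Subgroup.relIndex_eq_one.mp h1)
        exact hne (Subgroup.eq_of_le_of_card_ge hle (h₁.trans h₂.symm).le).symm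
    have hcentral : ∀ c ∈ M₁ ⊓ M₂, ∀ z, c * z = z * c := by
      intro c hc z
      have hcen : M₁ ⊔ M₂ ≤ Subgroup.centralizer {c} := by
        refine sup_le (fun m hm => ?_) (fun m hm => ?_) <;>
          rw [Subgroup.mem_centralizer_singleton_iff]
        · exact congrArg Subtype.val
            ((IsCyclic.commGroup (α := M₁)).mul_comm ⟨m, hm⟩ ⟨c, hc.1⟩)
        · exact congrArg Subtype.val
            ((IsCyclic.commGroup (α := M₂)).mul_comm ⟨m, hm⟩ ⟨c, hc.2⟩)
      have hz : z ∈ Subgroup.centralizer {c} := hcen (hsup ▸ Subgroup.mem_top z)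
      exact (Subgroup.mem_centralizer_singleton_iff.mp hz).symm
    obtain ⟨hpow₁, hcomm₁⟩ := M₁.pow_mem_and_commutator_mem_of_index_eq_prime (hindex M₁ h₁)
    obtain ⟨hpow₂, hcomm₂⟩ := M₂.pow_mem_and_commutator_mem_of_index_eq_prime (hindex M₂ h₂)
    -- Commutators and $p$-th powers lie in $M_1\cap M_2$, hence are central. Since $x$ centralizes
    -- $y^p$, the commutator $c$ has $c^p=1$; for odd $p$ the exponent $\binom p2$ is a multiple of
    -- $p$.
    have hmul : ∀ x y : P, (x * y) ^ p = x ^ p * y ^ p := by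
      intro x y
      set c := (x * y)⁻¹ * (y * x) with hcdef
      have hyx : y * x = x * y * c := by rw [hcdef]; group
      have hc := hcentral c ⟨hcomm₁ x y, hcomm₂ x y⟩
      have hcp : c ^ p = 1 := by
        have hconj : x⁻¹ * y * x = y * c := by
          rw [mul_assoc, hyx]; group
        have h1 : (x⁻¹ * y * x) ^ p = y ^ p := by
          have := conj_pow (i := p) (a := x⁻¹) (b := y)
          rw [inv_inv] at this
          rw [this, mul_assoc, hcentral (y ^ p) ⟨hpow₁ y, hpow₂ y⟩ x]
          group
        rw [hconj, (show Commute y c from (hc y).symm).mul_pow] at h1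
        simpa using h1
      rw [mul_pow_of_commutator_mem_center hc hyx, Nat.choose_two_right,
        Nat.mul_div_assoc _ (by obtain ⟨k, rfl⟩ := hodd; simp), pow_mul, hcp]
      simp
    let f : P →* P := MonoidHom.mk' (fun x => x ^ p) hmul
    have : Nontrivial P := Finite.one_lt_card_iff_nontrivial.mp
      (hcard ▸ one_lt_pow₀ hp.out.one_lt n.succ_ne_zero)
    obtain ⟨z, hz⟩ : ∃ z : Subgroup.center P, orderOf z = p := by
      have := hpg.center_nontrivial
      obtain ⟨m, hm⟩ := IsPGroup.iff_card.mp (hpg.to_subgroup (Subgroup.center P))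
      refine exists_prime_orderOf_dvd_card' p ?_
      rw [hm]
      refine dvd_pow_self p ?_
      rintro rfl
      exact (Finite.one_lt_card (α := Subgroup.center P)).ne' (by simpa using hm)
    have hz' : orderOf (z : P) = p := by rw [Subgroup.orderOf_coe, hz]
    -- With the kernel this small, the $p$-th powers fill a subgroup of order at least $p^n$ inside
    -- both $M_1$ and $M_2$, which forces $M_1=M_2$.
    have hker : f.ker ≤ Subgroup.zpowers (z : P) := by
      intro x hx
      refine huniq x z (Subgroup.mem_center_iff.mp z.2 x) hx ?_ ?_
      · rw [← hz']; exact pow_orderOf_eq_one _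
      · intro h; rw [h, orderOf_one] at hz'; exact hp.out.one_lt.ne hz'
    have hkcard : Nat.card f.ker ≤ p := by
      calc Nat.card f.ker ≤ Nat.card (Subgroup.zpowers (z : P)) := Subgroup.card_le_of_le hker
        _ = p := by rw [Nat.card_zpowers, hz']
    have hrange : p ^ n ≤ Nat.card f.range := by
      have h := f.ker.card_mul_index
      rw [Subgroup.index_ker, hcard, pow_succ, mul_comm (p ^ n)] at h
      refine Nat.le_of_mul_le_mul_left ?_ hp.out.pos
      rw [← h]
      exact Nat.mul_le_mul_right _ hkcard
    have hle : f.range ≤ M₁ ∧ f.range ≤ M₂ := by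
      constructor <;> rintro _ ⟨x, rfl⟩
      exacts [hpow₁ x, hpow₂ x]
    exact hne ((Subgroup.eq_of_le_of_card_ge hle.1 (h₁ ▸ hrange)).symm.trans
      (Subgroup.eq_of_le_of_card_ge hle.2 (h₂ ▸ hrange)))

/-! ### Fixed points of coprime actions -/

/-- An element of prime order `p` normalizing a `p'`-subgroup `M` and a coset `x M` fixes
an element of that coset. -/
theorem Subgroup.exists_mem_commute_mul_of_pow_prime_eq_one {Γ : Type*} [Group Γ] {p : ℕ}
    [hp : Fact p.Prime] (M : Subgroup Γ) [Finite M] (hpM : ¬ p ∣ Nat.card M) {h x : Γ}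
    (hh : h ^ p = 1) (hM : ∀ m ∈ M, h * m * h⁻¹ ∈ M) (hx : x⁻¹ * (h * x * h⁻¹) ∈ M) :
    ∃ m ∈ M, h * (x * m) = x * m * h := by
  classical
  have := Fintype.ofFinite M
  -- Conjugation by $h$ on the coset $xM$, transported to $M$ along $m\mapsto xm$. Its $p$-th power
  -- is the identity and $p\nmid|M|$, so it has a fixed point.
  let f : M → M := fun m => ⟨x⁻¹ * (h * x * h⁻¹) * (h * m * h⁻¹), M.mul_mem hx (hM m m.2)⟩
  have hf : Function.Injective f := fun a b hab => by
    have := congrArg Subtype.val hab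
    simpa [f] using this
  let σ : Equiv.Perm M := Equiv.ofBijective f (Finite.injective_iff_bijective.mp hf)
  have hσ : ∀ m : M, ((σ m : M) : Γ) = (x⁻¹ * h * x) * m * h⁻¹ := fun m => by
    change x⁻¹ * (h * x * h⁻¹) * (h * m * h⁻¹) = _
    group
  have hpow : ∀ (k : ℕ) (m : M), (((σ ^ k) m : M) : Γ) = (x⁻¹ * h ^ k * x) * m * (h ^ k)⁻¹ := by
    intro k
    induction k with
    | zero => simp
    | succ k ih =>
      intro m
      rw [pow_succ', Equiv.Perm.mul_apply, hσ, ih, pow_succ' h]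
      group
  obtain ⟨m, hm⟩ := Equiv.Perm.exists_fixed_point_of_prime (p := p) (n := 1)
    (by rwa [← Nat.card_eq_fintype_card]) (σ := σ)
    (by ext m; rw [pow_one, hpow, hh]; simp)
  refine ⟨m, m.2, ?_⟩
  have := hσ m
  rw [hm] at this
  nth_rewrite 2 [this]
  group

/-- In a coprime action of `K` on an abelian group `A`, the commutator `[A, K]` contains no
nontrivial fixed points. -/
theorem Subgroup.eq_one_of_mem_commutator_of_coprime {Γ : Type*} [Group Γ] (A K : Subgroup Γ)
    [Finite A] [Finite K] (hA : ∀ a ∈ A, ∀ b ∈ A, a * b = b * a)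
    (hK : ∀ k ∈ K, ∀ a ∈ A, k * a * k⁻¹ ∈ A) (hcop : (Nat.card A).Coprime (Nat.card K))
    {a : Γ} (ha : a ∈ ⁅A, K⁆) (hfix : ∀ k ∈ K, k * a = a * k) : a = 1 := by
  classical
  have := Fintype.ofFinite K
  let _ : CommGroup A :=
    { (inferInstance : Group A) with mul_comm := fun a b => Subtype.ext (hA a a.2 b b.2) }
  let c : K → A → A := fun k a => ⟨k * a * (k : Γ)⁻¹, hK k k.2 a a.2⟩
  -- The norm map: being $K$-invariant it kills $[A,K]$, while a fixed point $a$ goes to $a^{|K|}$.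
  let τ : A →* A := MonoidHom.mk' (fun a => ∏ k : K, c k a) fun a b => by
    rw [← Finset.prod_mul_distrib]
    refine Finset.prod_congr rfl fun k _ => Subtype.ext ?_
    change (k : Γ) * (a * b) * (k : Γ)⁻¹ = (k * a * (k : Γ)⁻¹) * (k * b * (k : Γ)⁻¹)
    group
  have hτ : ∀ (k : K) (a : A), τ (c k a) = τ a := fun k a => by
    refine Fintype.prod_equiv (Equiv.mulRight k) _ _ fun l => Subtype.ext ?_
    change (l : Γ) * (k * a * (k : Γ)⁻¹) * (l : Γ)⁻¹ = (l * k) * a * ((l * k : Γ))⁻¹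
    group
  have hle : ⁅A, K⁆ ≤ τ.ker.map A.subtype := by
    rw [Subgroup.commutator_le]
    intro b hb k hk
    refine ⟨⟨b, hb⟩ * c ⟨k, hk⟩ ⟨b, hb⟩⁻¹, ?_, ?_⟩
    · rw [SetLike.mem_coe, MonoidHom.mem_ker, map_mul, hτ, map_inv, mul_inv_cancel]
    · change b * (k * b⁻¹ * k⁻¹) = b * k * b⁻¹ * k⁻¹
      group
  obtain ⟨a, ha', rfl⟩ := hle ha
  have h1 : a ^ Nat.card K = 1 := by
    have : τ a = a ^ Nat.card K := by
      calc τ a = ∏ k : K, a := Finset.prod_congr rfl fun k _ => Subtype.ext (by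
            change (k : Γ) * a * (k : Γ)⁻¹ = a
            have : (k : Γ) * a = a * k := hfix k k.2
            rw [this, mul_inv_cancel_right])
        _ = _ := by simp [Nat.card_eq_fintype_card]
    rw [← this]; exact ha'
  have h2 : a ^ Nat.card A = 1 := pow_card_eq_one'
  have h3 := pow_gcd_eq_one.mpr ⟨h2, h1⟩
  rw [hcop.gcd_eq_one, pow_one] at h3
  simp [h3]

/-! ### Sylow subgroups of fixed point free groups -/

/-- In a group acting fixed point freely on a nontrivial abelian group of coprime order,
commuting elements of the same prime order generate the same subgroup. -/
theorem mem_zpowers_of_fixedPointFree {A K : Type*} [CommGroup A] [Finite A] [Nontrivial A]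
    [Group K] (φ : K →* MulAut A) (hφ : ∀ k : K, k ≠ 1 → ∀ a : A, φ k a = a → a = 1) {p : ℕ}
    [hp : Fact p.Prime] (hpA : ¬ p ∣ Nat.card A) {x y : K} (hxy : x * y = y * x)
    (hx : x ^ p = 1) (hy : y ^ p = 1) (hy1 : y ≠ 1) : x ∈ Subgroup.zpowers y := by
  by_contra hxmem
  have hxy : Commute x y := hxy
  -- Applying $g$ permutes the factors cyclically, so the product is a fixed point of $g$.
  have hnorm : ∀ g : K, g ≠ 1 → g ^ p = 1 → ∀ a : A,
      ∏ i ∈ Finset.range p, φ (g ^ i) a = 1 := by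
    intro g hg hgp a
    refine hφ g hg _ ?_
    rw [map_prod]
    have h1 : ∀ i, φ g (φ (g ^ i) a) = φ (g ^ (i + 1)) a := fun i => by
      rw [pow_succ', map_mul]; rfl
    simp_rw [h1]
    have h2 := (Finset.prod_range_succ' (fun i => φ (g ^ i) a) p).symm.trans
      (Finset.prod_range_succ (fun i => φ (g ^ i) a) p)
    rw [hgp, pow_zero] at h2
    exact mul_right_cancel h2
  have hpow : ∀ i, i < p → i ≠ 0 → y ^ i ≠ 1 := fun i hi hi0 h =>
    Nat.not_dvd_of_pos_of_lt (Nat.pos_of_ne_zero hi0) hi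
      (orderOf_eq_prime hy hy1 ▸ orderOf_dvd_of_pow_eq_one h)
  -- Multiply the norms of $a$ for $xy^j$, $0\le j<p$, and regroup by the exponent $i$. The terms
  -- with $i=0$ give $a^p$; those with $i\ne0$ give the image under $x^i$ of the norm of $a$ for
  -- $y^i$, which is trivial.
  have key : ∀ a : A, a ^ p = 1 := by
    intro a
    have h1 : ∏ j ∈ Finset.range p, ∏ i ∈ Finset.range p, φ ((x * y ^ j) ^ i) a = 1 := by
      refine Finset.prod_eq_one fun j _ => hnorm _ (fun h => hxmem ?_) ?_ a
      · rw [mul_eq_one_iff_eq_inv] at h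
        rw [h]
        exact inv_mem (pow_mem (Subgroup.mem_zpowers y) j)
      · rw [(hxy.pow_right j).mul_pow, hx, ← pow_mul, mul_comm j, pow_mul, hy]
        simp
    rw [Finset.prod_comm, ← Nat.succ_pred_eq_of_pos hp.out.pos, Finset.prod_range_succ'] at h1
    rw [Nat.succ_pred_eq_of_pos hp.out.pos] at h1
    rw [Finset.prod_eq_one, one_mul] at h1
    · simpa using h1
    · intro i hi
      have hi : i + 1 < p := Nat.succ_lt_of_lt_pred (Finset.mem_range.mp hi)
      have h2 : ∀ j, φ ((x * y ^ j) ^ (i + 1)) a = φ (x ^ (i + 1)) (φ ((y ^ (i + 1)) ^ j) a) := by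
        intro j
        rw [(hxy.pow_right j).mul_pow, ← pow_mul y j, mul_comm j, pow_mul y, map_mul]
        rfl
      simp_rw [h2]
      rw [← map_prod, hnorm _ (hpow _ hi i.succ_ne_zero), map_one]
      rw [← pow_mul, mul_comm, pow_mul, hy, one_pow]
  obtain ⟨a, ha⟩ := exists_ne (1 : A)
  refine hpA ?_
  rw [← orderOf_eq_prime (key a) ha]
  exact orderOf_dvd_natCard a

/-- A group of odd order acting fixed point freely on a nontrivial abelian group of coprime order
has cyclic Sylow subgroups. -/
theorem IsZGroup.of_fixedPointFree {A K : Type*} [CommGroup A] [Finite A] [Nontrivial A]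
    [Group K] [Finite K] (φ : K →* MulAut A) (hφ : ∀ k : K, k ≠ 1 → ∀ a : A, φ k a = a → a = 1)
    (hodd : Odd (Nat.card K)) (hcop : (Nat.card A).Coprime (Nat.card K)) : IsZGroup K := by
  refine ⟨fun p hp P => ?_⟩
  have := Fact.mk hp
  obtain ⟨n, hn⟩ := IsPGroup.iff_card.mp P.2
  rcases Nat.eq_zero_or_pos n with rfl | hpos
  · have : Subsingleton P := (Nat.card_eq_one_iff_unique.mp (by simpa using hn)).1
    infer_instance
  · have hpK : p ∣ Nat.card K :=
      (hn ▸ dvd_pow_self p hpos.ne' : p ∣ Nat.card P).trans (Subgroup.card_subgroup_dvd_card _)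
    have hpA : ¬ p ∣ Nat.card A := fun h => Nat.not_coprime_of_dvd_of_dvd hp.one_lt h hpK hcop
    refine isCyclic_of_card_eq_odd_prime_pow (hodd.of_dvd_nat hpK) n P hn ?_
    intro x y hxy hx hy hy1
    refine mem_zpowers_of_fixedPointFree (φ.comp (P : Subgroup K).subtype)
      (fun k hk a ha => hφ k (by simpa using hk) a ha) hpA hxy hx hy hy1

/-! ### Self-centralizing cyclic subgroups of Z-groups -/

namespace Subgroup

variable {Γ : Type*} [Group Γ]

/-- Automorphisms of a cyclic group are power maps and commute, so commutators die in
$N(F)/C(F)\hookrightarrow\mathrm{Aut}(F)$. -/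
theorem commutator_mem_centralizer_of_isCyclic (F : Subgroup Γ) [IsCyclic F] {x y : Γ}
    (hx : x ∈ normalizer (F : Set Γ)) (hy : y ∈ normalizer (F : Set Γ)) :
    x * y * x⁻¹ * y⁻¹ ∈ centralizer (F : Set Γ) := by
  have hcomm : ∀ σ τ : MulAut F, σ * τ = τ * σ := by
    intro σ τ
    obtain ⟨m, hm⟩ := MonoidHom.map_cyclic σ.toMonoidHom
    obtain ⟨n, hn⟩ := MonoidHom.map_cyclic τ.toMonoidHom
    replace hm : ∀ f, σ f = f ^ m := hm
    replace hn : ∀ f, τ f = f ^ n := hn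
    ext f
    simp only [MulAut.mul_apply]
    rw [hm, hn, hn, hm, ← zpow_mul, ← zpow_mul, mul_comm]
  let u : normalizer (F : Set Γ) := ⟨x, hx⟩
  let v : normalizer (F : Set Γ) := ⟨y, hy⟩
  have hker : u * v * u⁻¹ * v⁻¹ ∈ F.normalizerMonoidHom.ker := by
    rw [MonoidHom.mem_ker, map_mul, map_mul, map_mul, map_inv, map_inv,
      hcomm (F.normalizerMonoidHom u)]
    group
  rw [normalizerMonoidHom_ker, mem_subgroupOf] at hker
  exact hker

/-- A finite `Z`-group `H` has a cyclic, self-centralizing subgroup which is normalized by every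
element normalizing `H`. -/
theorem exists_isCyclic_self_centralizing (H : Subgroup Γ) [Finite H] [IsZGroup H] :
    ∃ F : Subgroup Γ, F ≤ H ∧ IsCyclic F ∧ H ⊓ centralizer (F : Set Γ) ≤ F ∧
      normalizer (H : Set Γ) ≤ normalizer (F : Set Γ) := by
  have hmap : (_root_.commutator H).map H.subtype = ⁅H, H⁆ := map_subtype_commutator H
  have hcommH : ⁅H, H⁆ ≤ H := commutator_le_self H
  have hab : ∀ a ∈ ⁅H, H⁆, ∀ b ∈ ⁅H, H⁆, a * b = b * a := by
    intro a ha b hb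
    rw [← hmap] at ha hb
    obtain ⟨a, ha, rfl⟩ := ha
    obtain ⟨b, hb, rfl⟩ := hb
    have : IsCyclic (_root_.commutator H) := IsZGroup.isCyclic_commutator H
    have := (IsCyclic.commGroup (α := _root_.commutator H)).mul_comm ⟨a, ha⟩ ⟨b, hb⟩
    exact congrArg (fun z : _root_.commutator H => ((z : H) : Γ)) this
  -- $F=C_H(H')$ contains the cyclic group $H'$, which makes it self-centralizing in $H$.
  let F : Subgroup Γ := H ⊓ centralizer (⁅H, H⁆ : Subgroup Γ)
  have hFH : F ≤ H := inf_le_left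
  have hle : ⁅H, H⁆ ≤ F := le_inf hcommH fun a ha => mem_centralizer_iff.mpr fun b hb =>
    hab b hb a ha
  refine ⟨F, hFH, ?_, ?_, ?_⟩
  · have hF : Finite F := Finite.of_injective _ (inclusion_injective hFH)
    have hZ : IsZGroup F := IsZGroup.of_injective (inclusion_injective hFH)
    -- The kernel of $F\to H/H'$ is contained in $H'$, central in $F$, and $H/H'$ is cyclic; so $F$
    -- is abelian, and an abelian Z-group is cyclic.
    have hcomm : IsMulCommutative F := by
      refine MonoidHom.isMulCommutative_of_isCyclic_of_ker_le_center (G' := Abelianization H)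
        (Abelianization.of.comp (inclusion hFH)) ?_
      intro a ha
      rw [mem_center_iff]
      intro b
      have hmem : (a : Γ) ∈ ⁅H, H⁆ := by
        rw [← hmap]
        refine ⟨inclusion hFH a, ?_, rfl⟩
        have := MonoidHom.mem_ker.mp ha
        rw [SetLike.mem_coe, ← Abelianization.ker_of H]
        exact this
      exact Subtype.ext (mem_centralizer_iff.mp b.2.2 a hmem).symm
    let _ : CommGroup F := { (inferInstance : Group F) with mul_comm := hcomm.1.comm }
    exact (inferInstance : IsCyclic F)
  · rintro h ⟨hh, hcen⟩
    exact ⟨hh, centralizer_le hle hcen⟩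
  · have key : ∀ g ∈ normalizer (H : Set Γ), ∀ f ∈ F, g * f * g⁻¹ ∈ F := by
      intro g hg f hf
      refine ⟨(mem_normalizer_iff.mp hg f).mp hf.1, mem_centralizer_iff.mpr fun c hc => ?_⟩
      have hc' : g⁻¹ * c * g ∈ ⁅H, H⁆ := by
        have hle : ⁅H, H⁆ ≤ ⁅H, H⁆.map (MulAut.conj g).toMonoidHom := by
          have hH : H ≤ H.map (MulAut.conj g).toMonoidHom := fun h hh =>
            ⟨g⁻¹ * h * g, (mem_normalizer_iff''.mp hg h).mp hh, by
              simp [mul_assoc]⟩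
          rw [map_commutator]
          exact commutator_mono hH hH
        obtain ⟨d, hd, hd'⟩ := hle hc
        have : g⁻¹ * c * g = d := by
          rw [← hd']
          simp [mul_assoc]
        rwa [this]
      have h1 : (g⁻¹ * c * g) * f = f * (g⁻¹ * c * g) := mem_centralizer_iff.mp hf.2 _ hc'
      calc c * (g * f * g⁻¹) = g * ((g⁻¹ * c * g) * f) * g⁻¹ := by group
        _ = g * f * g⁻¹ * c := by rw [h1]; group
    intro g hg
    rw [mem_normalizer_iff]
    refine fun f => ⟨key g hg f, fun hf => ?_⟩
    have := key g⁻¹ (inv_mem hg) _ hf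
    simpa [mul_assoc] using this

theorem isInternalSemidirect_sup {N K : Subgroup Γ} (hK : K ≤ normalizer (N : Set Γ))
    (hNK : N ⊓ K = ⊥) : IsInternalSemidirect (N ⊔ K) N K := by
  refine ⟨⟨le_sup_left, le_sup_right, hNK, (coe_mul_of_right_le_normalizer_left N K hK).symm⟩,
    fun x hx n hn => ?_⟩
  exact (mem_normalizer_iff.mp (sup_le le_normalizer hK hx) n).mp hn

end Subgroup

/-! ### From a coprime faithful action to double Frobenius groups -/

namespace Subgroup

open scoped commutatorElement

variable {Γ : Type*} [Group Γ]

/-- An element `β` of prime order normalizing `H` and acting trivially modulo a normal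
subgroup `F` of coprime order: `H = F C_H(β)`. -/
theorem exists_eq_mul_of_orderOf_prime {F H : Subgroup Γ} [Finite F] {β : Γ}
    (hβ : (orderOf β).Prime) (hcop : (Nat.card F).Coprime (orderOf β)) (hFH : F ≤ H)
    (hHF : H ≤ normalizer (F : Set Γ)) (hβF : β ∈ normalizer (F : Set Γ))
    (htriv : ∀ h ∈ H, h⁻¹ * (β * h * β⁻¹) ∈ F) {h : Γ} (hh : h ∈ H) :
    ∃ f ∈ F, ∃ c ∈ H, h = f * c ∧ β * c = c * β := by
  have := Fact.mk hβ
  obtain ⟨m, hm, hcomm⟩ := F.exists_mem_commute_mul_of_pow_prime_eq_one (p := orderOf β) (h := β)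
    (x := h) ((Nat.Prime.coprime_iff_not_dvd hβ).mp hcop.symm) (pow_orderOf_eq_one β)
    (fun m hm => (mem_normalizer_iff.mp hβF m).mp hm) (htriv h hh)
  have hc : h * m ∈ H := mul_mem hh (hFH hm)
  -- The fixed element $hm$ of $hF$ gives $h=(hm)m^{-1}$; conjugating $m^{-1}$ by $hm$ moves the
  -- $F$-factor to the left.
  refine ⟨h * m * m⁻¹ * (h * m)⁻¹, ?_, h * m, hc, by group, hcomm⟩
  exact (mem_normalizer_iff.mp (hHF hc) _).mp (inv_mem hm)

theorem inf_eq_bot_of_coprime_card {A B : Subgroup Γ} [Finite A] [Finite B]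
    (h : (Nat.card A).Coprime (Nat.card B)) : A ⊓ B = ⊥ := by
  refine card_eq_one.mp (Nat.eq_one_of_dvd_coprimes h ?_ ?_)
  exacts [card_dvd_of_le inf_le_left, card_dvd_of_le inf_le_right]

/-- The coprime case of the double Frobenius configuration: `H` acts fixed point freely on the
abelian normal subgroup `A`, and `Q` acts coprimely and faithfully on `H`. -/
theorem isDoubleFrobeniusGroup_of_faithful [Finite Γ] (A H Q : Subgroup Γ) [A.Normal]
    (hA : ∀ a ∈ A, ∀ b ∈ A, a * b = b * a) (hA1 : A ≠ ⊥)
    (hcop : (Nat.card A).Coprime (Nat.card H)) (hodd : Odd (Nat.card H))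
    (hfpf : ∀ h ∈ H, h ≠ 1 → ∀ a ∈ A, h * a * h⁻¹ = a → a = 1)
    (hQH : Q ≤ normalizer (H : Set Γ)) (hQcop : (Nat.card Q).Coprime (Nat.card H))
    (hdisj : (A ⊔ H) ⊓ Q = ⊥) (hfaith : Q.ActsFaithfullyOn H) :
    (∀ x ∈ Q, ∀ y ∈ Q, x * y = y * x) ∧
    ∀ β ∈ Q, (orderOf β).Prime →
      IsDoubleFrobeniusGroup (A ⊔ ⁅H, zpowers β⁆ ⊔ zpowers β) A ⁅H, zpowers β⁆ (zpowers β) := by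
  have hZ : IsZGroup H := by
    let _ : CommGroup A :=
      { (inferInstance : Group A) with mul_comm := fun a b => Subtype.ext (hA a a.2 b b.2) }
    have : Nontrivial A := (nontrivial_iff_ne_bot A).mpr hA1
    refine IsZGroup.of_fixedPointFree (A := A) ((MulAut.conjNormal (H := A)).comp H.subtype)
      (fun h hh a ha => ?_) hodd hcop
    refine Subtype.ext (hfpf h h.2 (by simpa using hh) a a.2 ?_)
    exact congrArg Subtype.val ha
  obtain ⟨F, hFH, hFcyc, hself, hnorm⟩ := exists_isCyclic_self_centralizing H
  have hHF : H ≤ normalizer (F : Set Γ) := le_normalizer.trans hnorm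
  have hQF : Q ≤ normalizer (F : Set Γ) := hQH.trans hnorm
  have hFcomm : ∀ a ∈ F, ∀ b ∈ F, a * b = b * a := fun a ha b hb =>
    congrArg Subtype.val ((IsCyclic.commGroup (α := F)).mul_comm ⟨a, ha⟩ ⟨b, hb⟩)
  have htriv : ∀ q ∈ Q, ∀ h ∈ H, h⁻¹ * (q * h * q⁻¹) ∈ F := by
    intro q hq h hh
    refine hself ⟨H.mul_mem (inv_mem hh) ((mem_normalizer_iff.mp (hQH hq) h).mp hh), ?_⟩
    have := F.commutator_mem_centralizer_of_isCyclic (inv_mem (hHF hh)) (hQF hq)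
    simpa [mul_assoc] using this
  have hFQ : ∀ q ∈ Q, (Nat.card F).Coprime (orderOf q) := fun q hq =>
    Nat.Coprime.of_dvd (card_dvd_of_le hFH)
      (Nat.card_zpowers q ▸ card_dvd_of_le ((zpowers_le).mpr hq)) hQcop.symm
  have hdecomp : ∀ β ∈ Q, (orderOf β).Prime → ∀ h ∈ H,
      ∃ f ∈ F, ∃ c ∈ H, h = f * c ∧ β * c = c * β := fun β hβ hp h hh =>
    exists_eq_mul_of_orderOf_prime hp (hFQ β hβ) hFH hHF (hQF hβ) (htriv β hβ) hh
  -- $Q$ is faithful already on $F$: a power of $q$ of prime order centralizes $F$ and, by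
  -- `hdecomp`, all of $H$.
  have hcent : ∀ q ∈ Q, (∀ f ∈ F, q * f = f * q) → q = 1 := by
    intro q hq hqF
    by_contra hq1
    have hord : orderOf q ≠ 1 := mt orderOf_eq_one_iff.mp hq1
    have hp := Nat.minFac_prime hord
    obtain ⟨k, hk⟩ : ∃ k, orderOf (q ^ k) = (orderOf q).minFac :=
      ⟨orderOf q / (orderOf q).minFac,
        orderOf_pow_orderOf_div (orderOf_pos q).ne' (Nat.minFac_dvd _)⟩
    have hqk : q ^ k = 1 := by
      refine hfaith.2 _ (pow_mem hq k) fun h hh => ?_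
      obtain ⟨f, hf, c, -, rfl, hc⟩ := hdecomp _ (pow_mem hq k) (hk ▸ hp) h hh
      have hfc : q ^ k * f = f * q ^ k := ((show Commute q f from hqF f hf).pow_left k).eq
      rw [mul_inv_eq_iff_eq_mul, ← mul_assoc, hfc, mul_assoc, hc, mul_assoc]
    rw [hqk, orderOf_one] at hk
    exact hp.one_lt.ne hk
  refine ⟨fun x hx y hy => ?_, fun β hβ hp => ?_⟩
  · have hmem := F.commutator_mem_centralizer_of_isCyclic (hQF hx) (hQF hy)
    have h1 := hcent _ (mul_mem (mul_mem (mul_mem hx hy) (inv_mem hx)) (inv_mem hy))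
      fun f hf => (mem_centralizer_iff.mp hmem f hf).symm
    rwa [mul_inv_eq_one, mul_inv_eq_iff_eq_mul] at h1
  · have hβ1 : β ≠ 1 := fun h => by
      rw [h, orderOf_one] at hp; exact Nat.not_prime_one hp
    have hβQ : zpowers β ≤ Q := zpowers_le.mpr hβ
    -- In $h=fc$ the factor $c$ commutes with $\beta$ and drops out of the commutator.
    have hB : ⁅H, zpowers β⁆ ≤ ⁅F, zpowers β⁆ := by
      rw [commutator_le]
      intro h hh b hb
      obtain ⟨k, rfl⟩ := mem_zpowers_iff.mp hb
      obtain ⟨f, hf, c, -, rfl, hc⟩ := hdecomp β hβ hp h hh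
      have hcb : β ^ k * c = c * β ^ k := ((show Commute β c from hc).zpow_left k).eq
      have : ⁅f * c, β ^ k⁆ = ⁅f, β ^ k⁆ := by
        rw [commutatorElement_def, commutatorElement_def, mul_assoc f c, ← hcb]
        group
      rw [this]
      exact commutator_mem_commutator hf hb
    have hBF : ⁅H, zpowers β⁆ ≤ F := by
      refine hB.trans (commutator_le.mpr fun f hf b hb => ?_)
      have := mul_mem hf ((mem_normalizer_iff.mp (hQF (hβQ hb)) _).mp (inv_mem hf))
      simpa [commutatorElement_def, mul_assoc] using this
    have hBH : ⁅H, zpowers β⁆ ≤ H := hBF.trans hFH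
    have hBdisj : H ⊓ zpowers β = ⊥ :=
      le_bot_iff.mp (hdisj ▸ inf_le_inf le_sup_right hβQ)
    have hβB : zpowers β ≤ normalizer ((⁅H, zpowers β⁆ : Subgroup Γ) : Set Γ) := by
      have hmap : ∀ b ∈ zpowers β, ∀ x ∈ ⁅H, zpowers β⁆, b * x * b⁻¹ ∈ ⁅H, zpowers β⁆ := by
        intro b hb x hx
        have h1 : ⁅H, zpowers β⁆.map (MulAut.conj b).toMonoidHom ≤ ⁅H, zpowers β⁆ := by
          rw [map_commutator]
          refine commutator_mono ?_ ?_
          · rintro _ ⟨h, hh, rfl⟩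
            exact (mem_normalizer_iff.mp (hQH (hβQ hb)) h).mp hh
          · rintro _ ⟨c, hc, rfl⟩
            exact mul_mem (mul_mem hb hc) (inv_mem hb)
        exact h1 ⟨x, hx, rfl⟩
      intro b hb
      rw [mem_normalizer_iff]
      refine fun x => ⟨hmap b hb x, fun hx => ?_⟩
      simpa [mul_assoc] using hmap b⁻¹ (inv_mem hb) _ hx
    have hAB : zpowers β ≤ normalizer ((A ⊔ ⁅H, zpowers β⁆ : Subgroup Γ) : Set Γ) := by
      rw [sup_comm]
      exact hβB.trans normalizer_le_normalizer_sup_normal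
    have hβ0 : zpowers β ≠ ⊥ := by simpa [zpowers_eq_bot] using hβ1
    have hB0 : ⁅H, zpowers β⁆ ≠ ⊥ := by
      intro h0
      refine hβ1 (hfaith.2 β hβ fun h hh => ?_)
      have h1 : ⁅h, β⁆ = 1 := by
        rw [← mem_bot, ← h0]
        exact commutator_mem_commutator hh (mem_zpowers β)
      rw [commutatorElement_eq_one_iff_mul_comm] at h1
      rw [← h1, mul_inv_cancel_right]
    refine ⟨isInternalSemidirect_sup hAB ?_, ⟨hA1, hB0, isInternalSemidirect_sup ?_ ?_, ?_⟩,
      hB0, hβ0, isInternalSemidirect_sup hβB ?_, ?_⟩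
    · exact le_bot_iff.mp (hdisj ▸ inf_le_inf (sup_le_sup_left hBH A) hβQ)
    · exact le_normalizer_of_normal
    · exact le_bot_iff.mp (inf_eq_bot_of_coprime_card hcop ▸ inf_le_inf_left A hBH)
    · exact fun k hk hk1 a ha => hfpf k (hBH hk) hk1 a ha
    · exact le_bot_iff.mp (hBdisj ▸ inf_le_inf_right _ hBH)
    · intro k hk hk1 n hn hkn
      refine F.eq_one_of_mem_commutator_of_coprime (zpowers β) hFcomm
        (fun b hb f hf => (mem_normalizer_iff.mp (hQF (hβQ hb)) f).mp hf)
        (by rw [Nat.card_zpowers]; exact hFQ β hβ) (hB hn) ?_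
      have := Fact.mk hp
      -- Prime order makes $k$ a generator of $\langle\beta\rangle$, so a fixed point of $k$ is
      -- fixed by all of $\langle\beta\rangle$.
      have hgen : β ∈ zpowers k := by
        have hz : zpowers k = zpowers β := by
          refine eq_of_le_of_card_ge (zpowers_le.mpr hk) ?_
          have hd : orderOf k ∣ orderOf β := by
            rw [← Nat.card_zpowers, ← Nat.card_zpowers]
            exact card_dvd_of_le (zpowers_le.mpr hk)
          rw [Nat.card_zpowers, Nat.card_zpowers]
          rcases (Nat.dvd_prime hp).mp hd with h | h
          · exact absurd (orderOf_eq_one_iff.mp h) hk1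
          · exact h.ge
        exact hz ▸ mem_zpowers β
      intro b hb
      obtain ⟨i, rfl⟩ := mem_zpowers_iff.mp hgen
      obtain ⟨j, rfl⟩ := mem_zpowers_iff.mp hb
      have hc : Commute k n := mul_inv_eq_iff_eq_mul.mp hkn
      exact ((hc.zpow_left i).zpow_left j).eq

end Subgroup

/-! ### T.I. Hall subgroups and the factorization $G=N_G(H)O$ -/

namespace Subgroup

open scoped commutatorElement

variable {G : Type*} [Group G]

theorem isPiNumber_compl_primeDivisors_iff (H : Subgroup G) (n : ℕ) :
    IsPiNumber H.primeDivisorsᶜ n ↔ (Nat.card H).Coprime n := by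
  constructor
  · intro h
    refine Nat.coprime_of_dvd fun p hp hpH hpn => h p hp hpn ⟨hp, hpH⟩
  · intro h p hp hpn hpH
    exact Nat.not_coprime_of_dvd_of_dvd hp.one_lt hpH.2 hpn h

theorem card_sup_dvd_of_normal (N K : Subgroup G) [N.Normal] :
    Nat.card (N ⊔ K : Subgroup G) ∣ Nat.card N * Nat.card K := by
  have h := relIndex_mul_relIndex ⊥ N (N ⊔ K) bot_le le_sup_left
  rw [relIndex_bot_left, relIndex_bot_left, relIndex_sup_left] at h
  rw [← h]
  exact mul_dvd_mul_left _ (relIndex_dvd_card _ _)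

theorem le_piPrimeCore {H N : Subgroup G} [hN : N.Normal]
    (hcop : (Nat.card H).Coprime (Nat.card N)) : N ≤ H.piPrimeCore :=
  le_sSup ⟨hN, (H.isPiNumber_compl_primeDivisors_iff _).mpr hcop⟩

/-- In a finite group the supremum is a finite join, and the order of a join of two normal subgroups
divides the product of their orders. -/
theorem coprime_card_piPrimeCore [Finite G] (H : Subgroup G) :
    (Nat.card H).Coprime (Nat.card H.piPrimeCore) := by
  let S : Set (Subgroup G) := {N | N.Normal ∧ IsPiNumber H.primeDivisorsᶜ (Nat.card N)}
  have hS : H.piPrimeCore = S.toFinite.toFinset.sup id := by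
    rw [Finset.sup_id_eq_sSup, Set.Finite.coe_toFinset]
    rfl
  rw [hS]
  refine (Finset.sup_induction
    (p := fun N : Subgroup G => N.Normal ∧ (Nat.card H).Coprime (Nat.card N)) ?_ ?_ ?_).2
  · exact ⟨inferInstance, by simp⟩
  · rintro M ⟨hM, hM'⟩ N ⟨hN, hN'⟩
    exact ⟨inferInstance, (hM'.mul_right hN').of_dvd_right (card_sup_dvd_of_normal M N)⟩
  · intro N hN
    rw [Set.Finite.mem_toFinset] at hN
    exact ⟨hN.1, (H.isPiNumber_compl_primeDivisors_iff _).mp hN.2⟩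

/-- The element $s$ witnesses $H\cap xHx^{-1}\ne1$, so T.I. gives $H\le xHx^{-1}$, with equality by
finiteness. -/
theorem IsTI.mem_normalizer [Finite G] {H : Subgroup G} (hTI : H.IsTI) {x s : G} (hs : s ∈ H)
    (hs1 : s ≠ 1) (hx : x⁻¹ * s * x ∈ H) : x ∈ normalizer (H : Set G) := by
  have hmem : ∀ y, y ∈ MulAut.conj x • H ↔ x⁻¹ * y * x ∈ H := fun y => by
    rw [mem_pointwise_smul_iff_inv_smul_mem, ← map_inv, MulAut.smul_def, MulAut.conj_apply, inv_inv]
  rcases hTI x with h | h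
  · rw [← inv_mem_iff]
    refine mem_normalizer_fintype fun y hy => ?_
    rw [inv_inv]
    exact (hmem y).mp (inf_eq_left.mp h hy)
  · have hmem' : s ∈ H ⊓ MulAut.conj x • H := ⟨hs, (hmem s).mpr hx⟩
    rw [h, mem_bot] at hmem'
    exact absurd hmem' hs1

theorem IsTI.normalizer_le [Finite G] {H S : Subgroup G} (hTI : H.IsTI) (hS : S ≤ H)
    (hS1 : S ≠ ⊥) : normalizer (S : Set G) ≤ normalizer (H : Set G) := by
  intro x hx
  obtain ⟨s, hs, hs1⟩ := S.bot_or_exists_ne_one.resolve_left hS1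
  exact hTI.mem_normalizer (hS hs) hs1 (hS ((mem_normalizer_iff''.mp hx _).mp hs))

/-- A T.I. subgroup which is a Hall subgroup of its normalizer contains Sylow subgroups of `G`. -/
theorem IsTI.exists_sylow_le [Finite G] {H : Subgroup G} (hTI : H.IsTI)
    (hHall : H.IsHallIn (normalizer (H : Set G))) {p : ℕ} [hp : Fact p.Prime]
    (hpH : p ∣ Nat.card H) : ∃ S : Sylow p G, (S : Subgroup G) ≤ H := by
  let S₀ : Sylow p H := default
  let S : Subgroup G := (S₀ : Subgroup H).map H.subtype
  have hSH : S ≤ H := map_subtype_le _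
  have hSp : IsPGroup p S := S₀.2.map H.subtype
  obtain ⟨n, hn⟩ := IsPGroup.iff_card.mp hSp
  have hrel : S.relIndex H = (S₀ : Subgroup H).index := by
    rw [relIndex, subgroupOf, comap_map_eq_self_of_injective H.subtype_injective]
  have hS1 : S ≠ ⊥ := by
    intro h
    rw [h, relIndex_bot_left] at hrel
    exact S₀.not_dvd_index (hrel ▸ hpH)
  -- $|N_G(S):S|$ divides $|N_G(H):S|=|N_G(H):H|\,|H:S|$. It is also congruent to $|G:S|$ modulo
  -- $p$, so $S$ is Sylow in $G$.
  have hdvd : ¬ p ∣ S.relIndex (normalizer (S : Set G)) := by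
    intro h
    have h1 : S.relIndex (normalizer (S : Set G)) ∣ S.relIndex (normalizer (H : Set G)) :=
      relIndex_mul_relIndex S _ _ le_normalizer (hTI.normalizer_le hSH hS1) ▸ dvd_mul_right _ _
    have h2 := h.trans h1
    rw [← relIndex_mul_relIndex S H _ hSH le_normalizer, hrel] at h2
    rcases (Nat.Prime.dvd_mul hp.out).mp h2 with h3 | h3
    · exact S₀.not_dvd_index h3
    · exact Nat.not_coprime_of_dvd_of_dvd hp.out.one_lt hpH h3 hHall.2
  have hmod := Sylow.card_quotient_normalizer_modEq_card_quotient hn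
  have hidx : ¬ p ∣ S.index := by
    intro h
    rw [index_eq_card] at h
    exact hdvd ((Nat.ModEq.dvd_iff hmod dvd_rfl).mpr h)
  exact ⟨hSp.toSylow hidx, hSH⟩

theorem IsTI.coprime_index [Finite G] {H : Subgroup G} (hTI : H.IsTI)
    (hHall : H.IsHallIn (normalizer (H : Set G))) : (Nat.card H).Coprime H.index := by
  refine Nat.coprime_of_dvd fun p hp hpH hpi => ?_
  have := Fact.mk hp
  obtain ⟨S, hS⟩ := hTI.exists_sylow_le hHall hpH
  exact S.not_dvd_index (hpi.trans (index_dvd_of_le hS))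

theorem relIndex_sup_eq_relIndex_of_normal [Finite G] (K M : Subgroup G) [M.Normal] :
    K.relIndex (K ⊔ M) = K.relIndex M := by
  have h1 := relIndex_mul_relIndex (M ⊓ K) M (K ⊔ M) inf_le_left le_sup_right
  have h2 := relIndex_mul_relIndex (M ⊓ K) K (K ⊔ M) inf_le_right le_sup_left
  rw [inf_relIndex_right, ← relIndex_sup_right] at h2
  rw [inf_relIndex_left, ← h2, mul_comm] at h1
  exact (Nat.eq_of_mul_eq_mul_left (Nat.pos_of_ne_zero index_ne_zero_of_finite) h1).symm

/-- The first term of the series outside $O$ yields a normal $M\ge O$ with $M/O$ a nontrivial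
$\pi$-group. Frattini for a Sylow subgroup of $M$ inside $H$ gives $G=N_G(H)M$, and an index count
replaces $M$ by $O$. -/
theorem IsTI.normalizer_sup_piPrimeCore [Finite G] {H : Subgroup G} (hTI : H.IsTI)
    (hHall : H.IsHallIn (normalizer (H : Set G))) (hH1 : H ≠ ⊥)
    (hsep : IsPiSeparable H.primeDivisors G) :
    normalizer (H : Set G) ⊔ H.piPrimeCore = ⊤ := by
  classical
  have hO := H.coprime_card_piPrimeCore
  obtain ⟨n, N, hN0, hNn, hnormal, hstep⟩ := hsep
  have hex : ∃ j, j ≤ n ∧ ¬ N j ≤ H.piPrimeCore := by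
    refine ⟨n, le_rfl, fun h => hH1 ?_⟩
    have htop : H.piPrimeCore = ⊤ := top_le_iff.mp (hNn ▸ h)
    rw [htop] at hO
    exact card_eq_one.mp (Nat.eq_one_of_dvd_coprimes hO dvd_rfl (card_dvd_of_le le_top))
  obtain ⟨hjn, hjO⟩ := Nat.find_spec hex
  have hmin := fun i => Nat.find_min hex (m := i)
  generalize Nat.find hex = j at hjn hjO hmin
  obtain _ | i := j
  · exact absurd (hN0 ▸ bot_le) hjO
  have hiO : N i ≤ H.piPrimeCore := by
    by_contra h
    exact hmin i i.lt_succ_self ⟨(Nat.le_succ i).trans hjn, h⟩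
  have := hnormal _ hjn
  obtain ⟨hle, hpi | hpi⟩ := hstep i hjn
  -- If the factor is a $\pi'$-group, then `N (i + 1)` is a normal $\pi'$-subgroup and lies in $O$
  -- after all.
  swap
  · refine absurd (le_piPrimeCore ?_) hjO
    have h := relIndex_mul_relIndex ⊥ (N i) (N (i + 1)) bot_le hle
    rw [relIndex_bot_left, relIndex_bot_left] at h
    rw [← h]
    exact (hO.of_dvd_right (card_dvd_of_le hiO)).mul_right
      ((H.isPiNumber_compl_primeDivisors_iff _).mp hpi)
  let M := N (i + 1) ⊔ H.piPrimeCore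
  have hOM : H.piPrimeCore ≤ M := le_sup_right
  have hrel : H.piPrimeCore.relIndex M ∣ (N i).relIndex (N (i + 1)) := by
    rw [relIndex_sup_right]
    exact relIndex_dvd_of_le_left _ hiO
  have hrel1 : H.piPrimeCore.relIndex M ≠ 1 := fun h =>
    hjO (le_sup_left.trans (relIndex_eq_one.mp h))
  obtain ⟨p, hp, hpr⟩ := Nat.exists_prime_and_dvd hrel1
  have := Fact.mk hp
  have hpH : p ∣ Nat.card H := (hpi p hp (hpr.trans hrel)).2
  obtain ⟨S, hS⟩ := hTI.exists_sylow_le hHall hpH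
  have hSM := relIndex_sup_eq_relIndex_of_normal (S : Subgroup G) M
  let T : Sylow p M := (S.2.comap_of_injective M.subtype M.subtype_injective).toSylow
    fun h => S.not_dvd_index (h.trans (hSM ▸ relIndex_dvd_index_of_le le_sup_left :
      (S : Subgroup G).relIndex M ∣ _))
  have hT : (T : Subgroup M).map M.subtype = (S : Subgroup G) ⊓ M := subgroupOf_map_subtype _ _
  have hT1 : (S : Subgroup G) ⊓ M ≠ ⊥ := by
    intro h
    rw [← hT, map_eq_bot_iff_of_injective _ M.subtype_injective] at h
    have := T.not_dvd_index
    rw [h, index_bot] at this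
    exact this (hpr.trans (relIndex_dvd_card _ _))
  have hfrattini := T.normalizer_sup_eq_top
  rw [hT] at hfrattini
  have hNM : normalizer (H : Set G) ⊔ M = ⊤ :=
    top_le_iff.mp (hfrattini ▸
      sup_le_sup_right (hTI.normalizer_le (inf_le_left.trans hS) hT1) M)
  -- This index divides $|M:O|$, a $\pi$-number, and $|G:H|$, a $\pi'$-number; hence it is 1.
  have hidx : (normalizer (H : Set G) ⊔ H.piPrimeCore).index
      = (normalizer (H : Set G) ⊔ H.piPrimeCore).relIndex M := by
    rw [← relIndex_sup_eq_relIndex_of_normal, ← relIndex_top_right]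
    congr 1
    exact (top_le_iff.mp (hNM ▸ sup_le_sup_right le_sup_left M)).symm
  by_contra hne
  obtain ⟨q, hq, hqi⟩ := Nat.exists_prime_and_dvd (mt index_eq_one.mp hne)
  have hqH : q ∣ Nat.card H := by
    refine (hpi q hq (.trans ?_ hrel)).2
    exact (hidx ▸ hqi).trans (relIndex_dvd_of_le_left _ le_sup_right)
  have hqi' : q ∣ H.index := hqi.trans (index_dvd_of_le (le_normalizer.trans le_sup_left))
  exact Nat.not_coprime_of_dvd_of_dvd hq.one_lt hqH hqi' (hTI.coprime_index hHall)

/-- A complement of a normal Hall subgroup has coprime order. -/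
theorem IsComplementIn.coprime_card {H Q K : Subgroup G} (hQ : Q.IsComplementIn H K)
    (hHall : H.IsHallIn K) (hK : K ≤ normalizer (H : Set G)) :
    (Nat.card H).Coprime (Nat.card Q) := by
  refine hHall.2.of_dvd_right ?_
  have : (H.subgroupOf K).Normal := normal_subgroupOf_of_le_normalizer hK
  have h1 := relIndex_dvd_index_of_normal (H.subgroupOf K) (Q.subgroupOf K)
  rw [relIndex_subgroupOf hQ.2.1, ← inf_relIndex_right, hQ.2.2.1, relIndex_bot_left] at h1
  exact h1

end Subgroup

/-! ### The quotient by $O'$ -/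

namespace Subgroup

open scoped commutatorElement

variable {G : Type*} [Group G]

theorem commutator_lt_self_of_isSolvable (O : Subgroup G) [Group.IsSolvable O] (hO : O ≠ ⊥) :
    ⁅O, O⁆ < O := by
  have : Nontrivial O := (nontrivial_iff_ne_bot O).mpr hO
  have h := Group.IsSolvable.commutator_lt_of_ne_bot (G := O) (H := ⊤) top_ne_bot
  have hmap : (_root_.commutator O).map O.subtype = ⁅O, O⁆ := map_subtype_commutator O
  refine lt_of_le_of_ne (commutator_le_self O) fun heq => h.ne ?_
  rw [heq] at hmap
  refine map_injective O.subtype_injective (hmap.trans ?_)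
  rw [← MonoidHom.range_eq_map, range_subtype]

/-- The commutator of $x$ and $h$ lies in $N\cap H$. -/
theorem commute_of_mem_normalizer {N H : Subgroup G} [hN : N.Normal] (hNH : N ⊓ H = ⊥) {x h : G}
    (hx : x ∈ N) (hxH : x ∈ normalizer (H : Set G)) (hh : h ∈ H) : h * x = x * h := by
  have h1 : x * h * x⁻¹ * h⁻¹ ∈ N ⊓ H := by
    refine ⟨?_, H.mul_mem ((mem_normalizer_iff.mp hxH h).mp hh) (inv_mem hh)⟩
    have := mul_mem hx (hN.conj_mem _ (inv_mem hx) h)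
    simpa [mul_assoc] using this
  rw [hNH, mem_bot, mul_inv_eq_one, mul_inv_eq_iff_eq_mul] at h1
  exact h1.symm

/-- The image of $q$ in $G/N$ has order dividing both $|H|$ and $|Q|$. -/
theorem mem_of_mem_sup_of_coprime [Finite G] {N H Q : Subgroup G} [N.Normal]
    (hcop : (Nat.card H).Coprime (Nat.card Q)) {q : G} (hq : q ∈ Q) (hqN : q ∈ N ⊔ H) : q ∈ N := by
  obtain ⟨a, ha, h, hh, rfl⟩ := mem_sup_of_normal_left.mp hqN
  rw [← QuotientGroup.eq_one_iff]
  have h1 : ((a * h : G) : G ⧸ N) = (h : G ⧸ N) := by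
    rw [QuotientGroup.mk_mul, (QuotientGroup.eq_one_iff a).mpr ha, one_mul]
  have h2 : ((a * h : G) : G ⧸ N) ^ Nat.card H = 1 := by
    rw [h1, ← QuotientGroup.mk_pow, orderOf_dvd_iff_pow_eq_one.mp (H.orderOf_dvd_natCard hh), QuotientGroup.mk_one]
  have h3 : ((a * h : G) : G ⧸ N) ^ Nat.card Q = 1 := by
    rw [← QuotientGroup.mk_pow, orderOf_dvd_iff_pow_eq_one.mp (Q.orderOf_dvd_natCard hq), QuotientGroup.mk_one]
  have h4 := pow_gcd_eq_one.mpr ⟨h2, h3⟩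
  rwa [hcop.gcd_eq_one, pow_one] at h4

theorem normalizer_le_normalizer_centralizer (H : Subgroup G) :
    normalizer (H : Set G) ≤ normalizer (centralizer (H : Set G) : Set G) := by
  have key : ∀ g ∈ normalizer (H : Set G), ∀ x ∈ centralizer (H : Set G),
      g * x * g⁻¹ ∈ centralizer (H : Set G) := by
    intro g hg x hx
    rw [mem_centralizer_iff]
    intro h hh
    have h1 := mem_centralizer_iff.mp hx _ ((mem_normalizer_iff''.mp hg h).mp hh)
    calc h * (g * x * g⁻¹) = g * (g⁻¹ * h * g * x) * g⁻¹ := by group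
      _ = g * x * g⁻¹ * h := by rw [h1]; group
  intro g hg
  rw [mem_normalizer_iff]
  refine fun x => ⟨key g hg x, fun hx => ?_⟩
  simpa [mul_assoc] using key g⁻¹ (inv_mem hg) _ hx

theorem card_comap_mk' [Finite G] (N : Subgroup G) [N.Normal] (L : Subgroup (G ⧸ N)) :
    Nat.card (L.comap (QuotientGroup.mk' N)) = Nat.card N * Nat.card L := by
  have hN : N ≤ L.comap (QuotientGroup.mk' N) := by
    conv_lhs => rw [← QuotientGroup.ker_mk' N]
    exact MonoidHom.ker_le_comap _ _
  have h := relIndex_mul_relIndex ⊥ N _ bot_le hN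
  have h2 := relIndex_ker (K := L.comap (QuotientGroup.mk' N)) (QuotientGroup.mk' N)
  rw [QuotientGroup.ker_mk', map_comap_eq_self_of_surjective (QuotientGroup.mk'_surjective N)] at h2
  rwa [relIndex_bot_left, relIndex_bot_left, h2, eq_comm] at h

/-- The structure of `G / [O, O]` when `O` is a solvable normal subgroup of order prime to `|H|`
containing all such normal subgroups, `[O, H] = O`, and `G = N_G(H) O`. -/
theorem IsTI.isDoubleFrobeniusGroup_quotient [Finite G] {H Q O : Subgroup G}
    (hTI : H.IsTI) (hnn : ¬ H.Normal) (hHall : H.IsHallIn (normalizer (H : Set G)))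
    (hQ : Q.IsComplementIn H (normalizer (H : Set G))) (hodd : Odd (Nat.card H))
    [hOnormal : O.Normal] (hOH : ⁅O, H⁆ = O) (hsolv : Group.IsSolvable O)
    (hcop : (Nat.card H).Coprime (Nat.card O)) (hsup : normalizer (H : Set G) ⊔ O = ⊤)
    (hcore : ∀ N : Subgroup G, N.Normal → (Nat.card H).Coprime (Nat.card N) → N ≤ O)
    (Obar Hbar Qbar : Subgroup (G ⧸ ⁅O, O⁆)) (hObar : Obar = O.map (QuotientGroup.mk' ⁅O, O⁆))
    (hHbar : Hbar = H.map (QuotientGroup.mk' ⁅O, O⁆))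
    (hQbar : Qbar = Q.map (QuotientGroup.mk' ⁅O, O⁆)) :
    (IsInternalSemidirect (Obar ⊔ Hbar) Obar Hbar ∧
      IsInternalSemidirect ⊤ (Obar ⊔ Hbar) Qbar) ∧
    ((∀ x ∈ Qbar, ∀ y ∈ Qbar, x * y = y * x) ∧ Qbar.ActsFaithfullyOn Hbar) ∧
    ∀ β ∈ Qbar, (orderOf β).Prime →
      IsDoubleFrobeniusGroup (Obar ⊔ ⁅Hbar, zpowers β⁆ ⊔ zpowers β)
        Obar ⁅Hbar, zpowers β⁆ (zpowers β) := by
  have hcopQ : (Nat.card H).Coprime (Nat.card Q) := hQ.coprime_card hHall le_rfl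
  have hQN : Q ≤ normalizer (H : Set G) := hQ.2.1
  have hOHbot : O ⊓ H = ⊥ := inf_eq_bot_of_coprime_card hcop.symm
  have hO1 : O ≠ ⊥ := by
    rintro rfl
    rw [sup_bot_eq] at hsup
    exact hnn (normalizer_eq_top_iff.mp hsup)
  have hlt : ⁅O, O⁆ < O := O.commutator_lt_self_of_isSolvable hO1
  set φ := QuotientGroup.mk' ⁅O, O⁆ with hφ
  have hφ1 : ∀ x, φ x = 1 ↔ x ∈ ⁅O, O⁆ := QuotientGroup.eq_one_iff
  have hker : φ.ker = ⁅O, O⁆ := QuotientGroup.ker_mk' _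
  have hφsurj : Function.Surjective φ := QuotientGroup.mk'_surjective _
  have hAnormal : Obar.Normal := hObar ▸ hOnormal.map φ hφsurj
  have hA1 : Obar ≠ ⊥ := by
    rw [hObar, Ne, map_eq_bot_iff, hker]
    exact hlt.not_ge
  have hAcomm : ∀ a ∈ Obar, ∀ b ∈ Obar, a * b = b * a := by
    rw [hObar]
    rintro _ ⟨a, ha, rfl⟩ _ ⟨b, hb, rfl⟩
    have h1 := (hφ1 _).mpr (commutator_mem_commutator ha hb)
    rwa [map_commutatorElement, commutatorElement_eq_one_iff_mul_comm] at h1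
  have hcopA : (Nat.card Obar).Coprime (Nat.card Hbar) := by
    rw [hObar, hHbar]
    exact (hcop.of_dvd (card_map_dvd H φ) (card_map_dvd O φ)).symm
  have hcopQbar : (Nat.card Qbar).Coprime (Nat.card Hbar) := by
    rw [hQbar, hHbar]
    exact (hcopQ.of_dvd (card_map_dvd H φ) (card_map_dvd Q φ)).symm
  have hcommbar : ⁅Obar, Hbar⁆ = Obar := by
    rw [hObar, hHbar, ← map_commutator, hOH]
  -- Such $x$ centralizes $H$, so its image is a fixed point of $\overline H$ in $\overline
  -- O=[\overline O,\overline H]$.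
  have hfix : ∀ x ∈ O, x ∈ normalizer (H : Set G) → φ x = 1 := by
    intro x hx hxH
    refine Obar.eq_one_of_mem_commutator_of_coprime Hbar hAcomm
      (fun k _ a ha => hAnormal.conj_mem a ha k) hcopA
      (hcommbar.symm ▸ hObar ▸ mem_map_of_mem φ hx) ?_
    rw [hHbar]
    rintro _ ⟨h, hh, rfl⟩
    rw [← map_mul, ← map_mul, commute_of_mem_normalizer hOHbot hx hxH hh]
  have hfpf : ∀ h ∈ Hbar, h ≠ 1 → ∀ a ∈ Obar, h * a * h⁻¹ = a → a = 1 := by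
    rw [hHbar, hObar]
    rintro _ ⟨h, hh, rfl⟩ hh1 _ ⟨x, hx, rfl⟩ hcomm
    have hh1 : orderOf h ≠ 1 := by
      rw [Ne, orderOf_eq_one_iff]
      rintro rfl
      exact hh1 (map_one φ)
    have hp := Nat.minFac_prime hh1
    obtain ⟨k, hk⟩ : ∃ k, orderOf (h ^ k) = (orderOf h).minFac :=
      ⟨_, orderOf_pow_orderOf_div (orderOf_pos h).ne' (Nat.minFac_dvd _)⟩
    have := Fact.mk hp
    have hpH : (orderOf h).minFac ∣ Nat.card H :=
      (Nat.minFac_dvd _).trans (H.orderOf_dvd_natCard hh)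
    have hpD : ¬ (orderOf h).minFac ∣ Nat.card (⁅O, O⁆ : Subgroup G) := fun hd =>
      Nat.not_coprime_of_dvd_of_dvd hp.one_lt hpH (hd.trans (card_dvd_of_le hlt.le)) hcop
    have hDnormal : (⁅O, O⁆ : Subgroup G).Normal := inferInstance
    have hcommk : φ (h ^ k) * φ x = φ x * φ (h ^ k) := by
      rw [map_pow]
      exact ((show Commute (φ h) (φ x) from mul_inv_eq_iff_eq_mul.mp hcomm).pow_left k).eq
    -- Replace $x$ within its coset $xO'$ by $xm$, which truly commutes with $h^k$; T.I. then puts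
    -- $xm$ in $N_G(H)$, where `hfix` applies.
    obtain ⟨m, hm, hmx⟩ := (⁅O, O⁆ : Subgroup G).exists_mem_commute_mul_of_pow_prime_eq_one
      (p := (orderOf h).minFac) hpD (h := h ^ k) (x := x) (hk ▸ pow_orderOf_eq_one _)
      (fun m hm => hDnormal.conj_mem m hm _)
      (by rw [← hφ1, map_mul, map_mul, map_mul, hcommk]; simp)
    have hxm : φ (x * m) = 1 := by
      refine hfix _ (mul_mem hx (hlt.le hm)) (hTI.mem_normalizer (pow_mem hh k) ?_ ?_)
      · intro h1
        rw [h1, orderOf_one] at hk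
        exact hp.one_lt.ne hk
      · rw [mul_assoc, hmx, inv_mul_cancel_left]
        exact pow_mem hh k
    rwa [map_mul, (hφ1 m).mpr hm, mul_one] at hxm
  have hQH : Qbar ≤ normalizer (Hbar : Set (G ⧸ ⁅O, O⁆)) := by
    rw [hQbar, hHbar]
    exact (map_mono hQN).trans (le_normalizer_map φ)
  have hdisj : (Obar ⊔ Hbar) ⊓ Qbar = ⊥ := by
    rw [eq_bot_iff, hQbar, hObar, hHbar, ← map_sup]
    rintro _ ⟨hx, q, hq, rfl⟩
    have hqO : q ∈ O ⊔ H := by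
      have h1 : q ∈ ((O ⊔ H).map φ).comap φ := hx
      rwa [comap_map_eq, hker, sup_of_le_left (hlt.le.trans le_sup_left)] at h1
    exact hfix q (mem_of_mem_sup_of_coprime hcopQ hq hqO) (hQN hq)
  have htop : Obar ⊔ Hbar ⊔ Qbar = ⊤ := by
    rw [hObar, hHbar, hQbar, ← map_sup, ← map_sup]
    suffices h : O ⊔ H ⊔ Q = ⊤ by rw [h, map_top_of_surjective φ hφsurj]
    rw [eq_top_iff, ← hsup, sup_assoc]
    refine sup_le (fun x hx => ?_) le_sup_left
    have h1 : x ∈ (H : Set G) * (Q : Set G) := hQ.2.2.2 ▸ hx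
    obtain ⟨h, hh, q, hq, rfl⟩ := h1
    exact mem_sup_right (mul_mem_sup hh hq)
  have hfaith : Qbar.ActsFaithfullyOn Hbar := by
    refine ⟨fun q hq h hh => (mem_normalizer_iff.mp (hQH hq) h).mp hh, fun q hq hqH => ?_⟩
    -- $K\overline O$ is normalized by $\overline O$, $\overline H$ and $\overline Q$, and its
    -- preimage in $G$ has order prime to $|H|$. So the preimage lies in $O$, and `hfix` kills $q$.
    let K := Qbar ⊓ centralizer (Hbar : Set (G ⧸ ⁅O, O⁆))
    have hK : q ∈ K := ⟨hq, mem_centralizer_iff.mpr fun h hh =>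
      (mul_inv_eq_iff_eq_mul.mp (hqH h hh)).symm⟩
    have hHK : Hbar ≤ normalizer (K : Set (G ⧸ ⁅O, O⁆)) := by
      intro h hh
      have hc : ∀ k ∈ K, h * k = k * h := fun k hk => mem_centralizer_iff.mp hk.2 h hh
      refine mem_normalizer_fintype fun k hk => ?_
      rwa [hc k hk, mul_inv_cancel_right]
    have hQK : Qbar ≤ normalizer (K : Set (G ⧸ ⁅O, O⁆)) :=
      (le_inf le_normalizer (hQH.trans (normalizer_le_normalizer_centralizer _))).trans
        inf_normalizer_le_normalizer_inf
    have hle : normalizer (K : Set (G ⧸ ⁅O, O⁆)) ≤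
        normalizer ((K ⊔ Obar : Subgroup (G ⧸ ⁅O, O⁆)) : Set (G ⧸ ⁅O, O⁆)) :=
      normalizer_le_normalizer_sup_normal
    have hL : (K ⊔ Obar).Normal := by
      rw [← normalizer_eq_top_iff, eq_top_iff, ← htop]
      exact sup_le (sup_le (le_sup_right.trans le_normalizer) (hHK.trans hle)) (hQK.trans hle)
    have hcardL : (Nat.card H).Coprime (Nat.card (K ⊔ Obar : Subgroup (G ⧸ ⁅O, O⁆))) := by
      rw [sup_comm]
      refine Nat.Coprime.of_dvd_right (card_sup_dvd_of_normal Obar K) (.mul_right ?_ ?_)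
      · rw [hObar]
        exact hcop.of_dvd_right (card_map_dvd O φ)
      · refine hcopQ.of_dvd_right ((card_dvd_of_le inf_le_left).trans ?_)
        rw [hQbar]
        exact card_map_dvd Q φ
    have hcomap : (K ⊔ Obar).comap φ ≤ O := by
      refine hcore _ (hL.comap φ) ?_
      rw [hφ, card_comap_mk']
      exact (hcop.of_dvd_right (card_dvd_of_le hlt.le)).mul_right hcardL
    have hq' := hq
    rw [hQbar] at hq'
    obtain ⟨q, hqQ, rfl⟩ := hq'
    exact hfix q (hcomap (mem_sup_left hK : φ q ∈ K ⊔ Obar)) (hQN hqQ)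
  obtain ⟨hab, hdouble⟩ := isDoubleFrobeniusGroup_of_faithful Obar Hbar Qbar hAcomm hA1 hcopA
    (hodd.of_dvd_nat (hHbar ▸ card_map_dvd H φ)) hfpf hQH hcopQbar hdisj hfaith
  refine ⟨⟨isInternalSemidirect_sup le_normalizer_of_normal (inf_eq_bot_of_coprime_card hcopA),
    ?_⟩, ⟨hab, hfaith⟩, hdouble⟩
  rw [← htop]
  refine isInternalSemidirect_sup ?_ hdisj
  rw [sup_comm]
  exact hQH.trans normalizer_le_normalizer_sup_normal

end Subgroup

theorem mainTheorem6 {G : Type*} [Group G] [Finite G] (H Q : Subgroup G)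
    (hTI : H.IsTI) (hnn : ¬ H.Normal)
    (hsep : IsPiSeparable H.primeDivisors G)
    (hHall : H.IsHallIn (Subgroup.normalizer (H : Set G)))
    (hQ : Q.IsComplementIn H (Subgroup.normalizer (H : Set G)))
    (hodd : Odd (Nat.card H))
    (hOH : ⁅H.piPrimeCore, H⁆ = H.piPrimeCore)
    (hsolv : Group.IsSolvable H.piPrimeCore)
    (hQO : ¬ Q ≤ ⁅H.piPrimeCore, H.piPrimeCore⁆)
    (Obar Hbar Qbar : Subgroup (G ⧸ ⁅H.piPrimeCore, H.piPrimeCore⁆))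
    (hObar : Obar = H.piPrimeCore.map (QuotientGroup.mk' ⁅H.piPrimeCore, H.piPrimeCore⁆))
    (hHbar : Hbar = H.map (QuotientGroup.mk' ⁅H.piPrimeCore, H.piPrimeCore⁆))
    (hQbar : Qbar = Q.map (QuotientGroup.mk' ⁅H.piPrimeCore, H.piPrimeCore⁆)) :
    (Subgroup.IsInternalSemidirect (Obar ⊔ Hbar) Obar Hbar ∧
      Subgroup.IsInternalSemidirect ⊤ (Obar ⊔ Hbar) Qbar) ∧
    ((∀ x ∈ Qbar, ∀ y ∈ Qbar, x * y = y * x) ∧ Qbar.ActsFaithfullyOn Hbar) ∧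
    ∀ β ∈ Qbar, (orderOf β).Prime →
      Subgroup.IsDoubleFrobeniusGroup (Obar ⊔ ⁅Hbar, Subgroup.zpowers β⁆ ⊔ Subgroup.zpowers β)
        Obar ⁅Hbar, Subgroup.zpowers β⁆ (Subgroup.zpowers β) := by
  exact hTI.isDoubleFrobeniusGroup_quotient hnn hHall hQ hodd hOH hsolv H.coprime_card_piPrimeCore
    (hTI.normalizer_sup_piPrimeCore hHall (fun h => hnn (h ▸ inferInstance)) hsep)
    (fun _ _ h => Subgroup.le_piPrimeCore h) Obar Hbar Qbar hObar hHbar hQbar
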